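/- Let $P=(X,\prec)$ be a finite poset with $|X|=n$, and let $x,y\in X$ (not necessarily distinct). A linear extension of $P$ is a bijection $f:X\to\{1,\dots,n\}$ such that $u\prec v$ implies $f(u)<f(v)$ for all $u,v\in X$. Let $f$ be a uniformly random linear extension of $P$, with $\mathbb{E}$ and $\mathrm{Cov}$ denoting expectation and covariance over $f$. Then $\mathbb{E}[f(x)]\cdot\mathbb{E}[f(y)]>0$ and $$\frac{\mathbb{E}[f(x)f(y)]+\mathbb{E}\big[\min\{f(x),f(y)\}\big]}{\mathbb{E}[f(x)]\cdot\mathbb{E}[f(y)]}\;\le\;2 .$$ Consequently, $\mathrm{Cov}(f(x),f(y))\le \mathbb{E}[f(x)]\cdot\mathbb{E}[f(y)]$. -/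

import Mathlib

/-- A linear extension of a finite poset `X` with `n` elements: a bijection
`f : X → {1, …, n}` such that `x < y` implies `f x < f y`. -/
def LinExt (X : Type*) [Fintype X] [PartialOrder X] : Type _ :=
  {f : X ≃ Finset.Icc 1 (Fintype.card X) // ∀ x y : X, x < y → f x < f y}

namespace LinExt

open Classical in
noncomputable instance instFintype (X : Type*) [Fintype X] [PartialOrder X] :
    Fintype (LinExt X) :=
  inferInstanceAs (Fintype
    {f : X ≃ Finset.Icc 1 (Fintype.card X) // ∀ x y : X, x < y → f x < f y})

/-- The value `f x ∈ {1, …, n}`, as a real number. -/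
def val {X : Type*} [Fintype X] [PartialOrder X] (f : LinExt X) (x : X) : ℝ :=
  ((f.1 x : ℕ) : ℝ)

/-- The expectation `E[g(f)]` of a real statistic `g` of a uniformly random linear
extension `f` of `X`. -/
noncomputable def expect {X : Type*} [Fintype X] [PartialOrder X] (g : LinExt X → ℝ) : ℝ :=
  (∑ f : LinExt X, g f) / (Fintype.card (LinExt X) : ℝ)

/-- The covariance `E[(g - E g) (h - E h)]` of two real statistics of a uniformly random
linear extension of `X`. -/
noncomputable def cov {X : Type*} [Fintype X] [PartialOrder X] (g h : LinExt X → ℝ) : ℝ :=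
  expect fun f => (g f - expect g) * (h f - expect h)

end LinExt

/-! Everything reduces to the one-element bound `E[f(x)^2 + f(x)] ≤ 2 E[f(x)]^2`; a weighted AM-GM
inequality then gives the mixed bound for `x` and `y`.

The left side is the second moment, and `E[f(x)]` the first, of a sum of `f(x)` independent Exp(1)
variables. The discrete model is a monotone `w : X → ℕ` with weight `q ^ max w`. Sorting `w` splits
it into a linear extension and successive gaps whose total is `max w`, so the gaps behave like
independent geometric variables. As `q → 1`, ties become negligible and `(1 - q) * w x` has the
moments of that exponential sum.

In this model the four functions theorem, applied to one family and a translate of another, shows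
that the tail of `w x` is submultiplicative (`tailWeight_add_mul_le`). Summing over both tail
parameters gives `weighted_second_moment_le`, and the limit gives `second_moment_le`. -/

/-- The finitely many monotone maps `X → {0, …, T - 1}`. -/
noncomputable def boundedMonotone (X : Type*) [Fintype X] [PartialOrder X] (T : ℕ) :
    Finset (X → ℕ) := by
  classical exact (Fintype.piFinset fun _ => Finset.range T).filter Monotone

/-! ### Tails and second moments of weighted monotone maps. -/

section BoundedMonotone

open Finset
open scoped FinsetFamily

theorem sup_add_const {X : Type*} [Fintype X] (x : X) (w : X → ℕ) (i : ℕ) :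
    univ.sup (fun u => w u + i) = univ.sup w + i := by
  apply le_antisymm
  · exact Finset.sup_le fun u _ => Nat.add_le_add_right (le_sup (f := w) (mem_univ u)) i
  · obtain ⟨u, -, hu⟩ := exists_mem_eq_sup univ ⟨x, mem_univ x⟩ w
    rw [hu]
    exact le_sup (f := fun u => w u + i) (mem_univ u)

variable {X : Type*} [Fintype X] [PartialOrder X]

theorem mem_boundedMonotone {T : ℕ} {w : X → ℕ} :
    w ∈ boundedMonotone X T ↔ (∀ u, w u < T) ∧ Monotone w := by
  simp [boundedMonotone, Fintype.mem_piFinset]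

/-- The total weight `∑ q ^ max w` over monotone `w` with `i ≤ w x`. -/
noncomputable def tailWeight (q : ℝ) (T : ℕ) (x : X) (i : ℕ) : ℝ :=
  ∑ w ∈ boundedMonotone X T with i ≤ w x, q ^ univ.sup w

/-- The weighted law of `w x` is "new better than used". -/
theorem tailWeight_add_mul_le {q : ℝ} (hq : 0 < q) (hq1 : q ≤ 1) (T : ℕ) (x : X) (i j : ℕ) :
    tailWeight q T x (i + j) * tailWeight q T x 0 ≤ tailWeight q T x i * tailWeight q T x j := by
  classical
  let W : (X → ℕ) → ℝ := fun w => q ^ univ.sup w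
  let shift : (X → ℕ) → (X → ℕ) := fun w u => w u + i
  have hinj : Function.Injective shift := fun a b h => by
    funext u; simpa [shift] using congrFun h u
  have hW : 0 ≤ W := fun w => by positivity
  have hshift : ∀ s : Finset (X → ℕ), ∑ w ∈ s.image shift, W w = q ^ i * ∑ w ∈ s, W w := by
    intro s
    rw [sum_image hinj.injOn, mul_sum]
    refine sum_congr rfl fun w _ => ?_
    simp only [W, shift]
    rw [sup_add_const x, pow_add, mul_comm]
  -- The maximum is additive or better under join and meet: `max (a ⊔ b) + max (a ⊓ b) ≤ max a + max
  -- b`. As `q ≤ 1`, this is the hypothesis on the weights. Translating the second family by `i`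
  -- makes every meet at least `i` at `x`.
  have key := four_functions_theorem W W W W hW hW hW hW (fun a b => by
    simp only [W, ← pow_add]
    apply pow_le_pow_of_le_one hq.le hq1
    have h1 : univ.sup (a ⊔ b) = univ.sup a ⊔ univ.sup b := Finset.sup_sup
    have h2 : univ.sup (a ⊓ b) ≤ univ.sup a ⊓ univ.sup b :=
      le_inf (sup_mono_fun fun u _ => inf_le_left) (sup_mono_fun fun u _ => inf_le_right)
    rw [h1]
    omega)
    ((boundedMonotone X T).filter fun w => i + j ≤ w x) ((boundedMonotone X T).image shift)
  have hinf : ((boundedMonotone X T).filter fun w => i + j ≤ w x) ⊼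
      ((boundedMonotone X T).image shift) ⊆ (boundedMonotone X T).filter fun w => i ≤ w x := by
    rw [infs_subset_iff]
    intro a ha b hb
    obtain ⟨b, hb', rfl⟩ := mem_image.1 hb
    simp only [mem_filter, mem_boundedMonotone] at ha hb' ⊢
    refine ⟨⟨fun u => lt_of_le_of_lt inf_le_left (ha.1.1 u),
      ha.1.2.inf fun u v huv => Nat.add_le_add_right (hb'.2 huv) i⟩, le_inf (by omega) ?_⟩
    exact Nat.le_add_left i (b x)
  have hsup : ((boundedMonotone X T).filter fun w => i + j ≤ w x) ⊻
      ((boundedMonotone X T).image shift) ⊆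
        ((boundedMonotone X T).filter fun w => j ≤ w x).image shift := by
    rw [sups_subset_iff]
    intro a ha b hb
    obtain ⟨b, hb', rfl⟩ := mem_image.1 hb
    simp only [mem_filter, mem_boundedMonotone] at ha hb'
    -- Truncated subtraction is harmless: `b u + i ≥ i` dominates wherever `a u < i`.
    refine mem_image.2 ⟨fun u => (a u - i) ⊔ b u, ?_, ?_⟩
    · simp only [mem_filter, mem_boundedMonotone]
      refine ⟨⟨fun u => ?_, fun u v huv => ?_⟩, ?_⟩
      · have := ha.1.1 u
        have := hb'.1 u
        exact max_lt (by omega) (by omega)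
      · exact max_le_max (Nat.sub_le_sub_right (ha.1.2 huv) i) (hb'.2 huv)
      · exact le_max_of_le_left (by omega)
    · funext u
      simp only [shift, Pi.sup_apply]
      omega
  have h3 : ∑ w ∈ ((boundedMonotone X T).filter fun w => i + j ≤ w x) ⊼
      ((boundedMonotone X T).image shift), W w ≤ tailWeight q T x i :=
    sum_le_sum_of_subset_of_nonneg hinf fun w _ _ => hW w
  have h4 : ∑ w ∈ ((boundedMonotone X T).filter fun w => i + j ≤ w x) ⊻
      ((boundedMonotone X T).image shift), W w ≤ q ^ i * tailWeight q T x j := by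
    unfold tailWeight
    rw [← hshift]
    exact sum_le_sum_of_subset_of_nonneg hsup fun w _ _ => hW w
  rw [hshift] at key
  have h0 : tailWeight q T x 0 = ∑ w ∈ boundedMonotone X T, W w := by simp [tailWeight, W]
  have h5 : tailWeight q T x (i + j) * (q ^ i * tailWeight q T x 0) ≤
      tailWeight q T x i * (q ^ i * tailWeight q T x j) := by
    rw [h0]
    exact key.trans (mul_le_mul h3 h4 (sum_nonneg fun w _ => hW w)
      (sum_nonneg fun w _ => hW w))
  have hqi : 0 < q ^ i := by positivity
  refine le_of_mul_le_mul_left ?_ hqi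
  linarith

/-- There are `(w + 1)(w + 2) / 2` pairs with `i + j ≤ w`, all inside the box since `w < T`. -/
theorem sq_le_two_mul_sum_tail {T w : ℕ} (hw : w < T) :
    (w : ℝ) ^ 2 ≤ 2 * ∑ i ∈ range T, ∑ j ∈ range T, if i + j ≤ w then (1 : ℝ) else 0 := by
  have h1 : ∑ i ∈ range (w + 1), ((w + 1 - i : ℕ) : ℝ) ≤
      ∑ i ∈ range T, ∑ j ∈ range T, if i + j ≤ w then (1 : ℝ) else 0 := by
    refine (sum_le_sum fun i _ => ?_).trans
      (sum_le_sum_of_subset_of_nonneg (range_subset_range.2 hw) fun i _ _ =>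
        sum_nonneg fun j _ => by split_ifs <;> simp)
    rw [← sum_filter, sum_const, nsmul_one]
    have : range (w + 1 - i) ⊆ (range T).filter fun j => i + j ≤ w := by
      intro j
      simp only [mem_range, mem_filter]
      omega
    exact_mod_cast (card_range (w + 1 - i)).symm.le.trans (card_le_card this)
  have h2 : ∀ m : ℕ, ∑ i ∈ range m, ((m - i : ℕ) : ℝ) = m * (m + 1) / 2 := by
    intro m
    induction m with
    | zero => simp
    | succ m ih =>
      rw [sum_range_succ']
      simp only [Nat.add_sub_add_right, ih]
      push_cast
      ring
  rw [h2] at h1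
  push_cast at h1
  nlinarith [(Nat.cast_nonneg w : (0 : ℝ) ≤ w)]

theorem sum_indicator_le {T w : ℕ} (hw : w < T) :
    ∑ i ∈ range T, (if i ≤ w then (1 : ℝ) else 0) = w + 1 := by
  rw [← sum_filter, sum_const, nsmul_one]
  have : (range T).filter (fun i => i ≤ w) = range (w + 1) := by
    ext i
    simp only [mem_range, mem_filter]
    omega
  rw [this, card_range]
  push_cast
  rfl

theorem tailWeight_eq (q : ℝ) (T : ℕ) (x : X) (i : ℕ) :
    tailWeight q T x i =
      ∑ w ∈ boundedMonotone X T, q ^ univ.sup w * if i ≤ w x then (1 : ℝ) else 0 := by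
  simp [tailWeight, sum_filter]

/-- Second moment bound for the weighted law of `w x`. -/
theorem weighted_second_moment_le {q : ℝ} (hq : 0 < q) (hq1 : q ≤ 1) (T : ℕ) (x : X) :
    (∑ w ∈ boundedMonotone X T, q ^ univ.sup w) *
        ∑ w ∈ boundedMonotone X T, q ^ univ.sup w * (w x : ℝ) ^ 2 ≤
      2 * (∑ w ∈ boundedMonotone X T, q ^ univ.sup w * ((w x : ℝ) + 1)) ^ 2 := by
  have h0 : ∑ w ∈ boundedMonotone X T, q ^ univ.sup w = tailWeight q T x 0 := by
    simp [tailWeight]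
  -- The tail sum starts at `i = 0`, hence `w x + 1`; the extra 1 vanishes after scaling by `1 - q`.
  have h1 : ∑ w ∈ boundedMonotone X T, q ^ univ.sup w * ((w x : ℝ) + 1) =
      ∑ i ∈ range T, tailWeight q T x i := by
    simp only [tailWeight_eq]
    rw [sum_comm]
    refine sum_congr rfl fun w hw => ?_
    rw [← mul_sum, sum_indicator_le ((mem_boundedMonotone.1 hw).1 x)]
  have h2 : ∑ w ∈ boundedMonotone X T, q ^ univ.sup w * (w x : ℝ) ^ 2 ≤
      2 * ∑ i ∈ range T, ∑ j ∈ range T, tailWeight q T x (i + j) := by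
    have : ∑ i ∈ range T, ∑ j ∈ range T, tailWeight q T x (i + j) =
        ∑ w ∈ boundedMonotone X T, q ^ univ.sup w *
          ∑ i ∈ range T, ∑ j ∈ range T, if i + j ≤ w x then (1 : ℝ) else 0 := by
      simp only [tailWeight_eq, mul_sum]
      rw [sum_comm]
      refine (sum_congr rfl fun j _ => sum_comm).trans ?_
      rw [sum_comm]
      exact sum_congr rfl fun w _ => sum_comm
    rw [this, mul_sum]
    refine sum_le_sum fun w hw => ?_
    have := sq_le_two_mul_sum_tail ((mem_boundedMonotone.1 hw).1 x)
    have hp : (0 : ℝ) ≤ q ^ univ.sup w := by positivity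
    nlinarith [mul_le_mul_of_nonneg_left this hp]
  have hnn : 0 ≤ tailWeight q T x 0 := sum_nonneg fun w _ => by positivity
  rw [h0, h1]
  refine (mul_le_mul_of_nonneg_left h2 hnn).trans ?_
  rw [sq, sum_mul_sum, mul_left_comm, mul_sum]
  gcongr with i
  rw [mul_sum]
  refine sum_le_sum fun j _ => ?_
  rw [mul_comm]
  exact tailWeight_add_mul_le hq hq1 T x i j

end BoundedMonotone

/-! ### Linear extensions and gap decompositions. -/

namespace LinExt

open Finset

variable {X : Type*} [Fintype X] [PartialOrder X]

/-- The value `f u` as a natural number. -/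
def rank (f : LinExt X) (u : X) : ℕ := (f.1 u : ℕ)

theorem rank_injective (f : LinExt X) : Function.Injective f.rank :=
  Subtype.val_injective.comp f.1.injective

theorem one_le_rank (f : LinExt X) (u : X) : 1 ≤ f.rank u := (Finset.mem_Icc.1 (f.1 u).2).1

theorem rank_le_card (f : LinExt X) (u : X) : f.rank u ≤ Fintype.card X :=
  (Finset.mem_Icc.1 (f.1 u).2).2

theorem rank_strictMono (f : LinExt X) : StrictMono f.rank := fun u v h => f.2 u v h

theorem exists_rank_eq (f : LinExt X) {m : ℕ} (h1 : 1 ≤ m) (h2 : m ≤ Fintype.card X) :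
    ∃ u, f.rank u = m := by
  obtain ⟨u, hu⟩ := f.1.surjective ⟨m, Finset.mem_Icc.2 ⟨h1, h2⟩⟩
  exact ⟨u, by simp [rank, hu]⟩

theorem rank_ext {f g : LinExt X} (h : ∀ u, f.rank u = g.rank u) : f = g :=
  Subtype.ext (Equiv.ext fun u => Subtype.ext (h u))

/-- The elements placed no later than rank `m`. -/
def initial (f : LinExt X) (m : ℕ) : Finset X := univ.filter fun v => f.rank v ≤ m

theorem mem_initial {f : LinExt X} {m : ℕ} {v : X} : v ∈ f.initial m ↔ f.rank v ≤ m := by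
  simp [initial]

theorem card_initial_rank (f : LinExt X) (u : X) : (f.initial (f.rank u)).card = f.rank u := by
  have : (f.initial (f.rank u)).image f.rank = Icc 1 (f.rank u) := by
    ext m
    simp only [mem_image, mem_initial, mem_Icc]
    constructor
    · rintro ⟨v, hv, rfl⟩
      exact ⟨f.one_le_rank v, hv⟩
    · rintro ⟨h1, h2⟩
      obtain ⟨v, rfl⟩ := f.exists_rank_eq h1 (h2.trans (f.rank_le_card u))
      exact ⟨v, h2, rfl⟩
  rw [← card_image_of_injective _ f.rank_injective, this, Nat.card_Icc, Nat.add_sub_cancel]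

theorem initial_zero (f : LinExt X) : f.initial 0 = ∅ := by
  ext v
  have := f.one_le_rank v
  simp only [mem_initial, notMem_empty, iff_false]
  omega

theorem initial_card (f : LinExt X) : f.initial (Fintype.card X) = univ := by
  ext v
  simp [mem_initial, f.rank_le_card v]

theorem initial_succ [DecidableEq X] (f : LinExt X) {m : ℕ} {u : X} (hu : f.rank u = m + 1) :
    f.initial (m + 1) = insert u (f.initial m) := by
  ext v
  simp only [mem_initial, mem_insert]
  constructor
  · intro h
    rcases Nat.lt_or_ge m (f.rank v) with h' | h'
    · exact Or.inl (f.rank_injective (by omega))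
    · exact Or.inr h'
  · rintro (rfl | h) <;> omega

theorem notMem_initial {f : LinExt X} {m : ℕ} {u : X} (hu : f.rank u = m + 1) :
    u ∉ f.initial m := by
  rw [mem_initial]
  omega

/-- Every monotone map to `ℕ` is weakly increasing along some linear extension. -/
theorem exists_compatible {w : X → ℕ} (hw : Monotone w) :
    ∃ f : LinExt X, ∀ u v, f.rank u ≤ f.rank v → w u ≤ w v := by
  classical
  -- Sort by `w`, breaking ties by a fixed linear extension of the order.
  let key : X → ℕ ×ₗ LinearExtension X := fun u => toLex (w u, toLinearExtension u)
  have hkinj : Function.Injective key := fun u v h => by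
    have := congrArg (fun p => (ofLex p).2) h
    exact this
  have hkmono : ∀ u v, u < v → key u < key v := fun u v h =>
    lt_of_le_of_ne (Prod.Lex.toLex_mono (show (w u, toLinearExtension u) ≤ _ from
      ⟨hw h.le, toLinearExtension.monotone h.le⟩)) fun e => h.ne (hkinj e)
  let r : X → ℕ := fun u => (univ.filter fun v => key v ≤ key u).card
  have hr : ∀ u v, key u < key v → r u < r v := fun u v h => by
    apply card_lt_card
    rw [ssubset_iff_of_subset]
    · exact ⟨v, by simp, by simpa using h⟩
    · intro t
      simp only [mem_filter, mem_univ, true_and]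
      exact fun ht => ht.trans h.le
  have hmem : ∀ u, r u ∈ Icc 1 (Fintype.card X) := fun u =>
    mem_Icc.2 ⟨card_pos.2 ⟨u, by simp⟩, card_le_univ _⟩
  have hinj : Function.Injective fun u => (⟨r u, hmem u⟩ : Icc 1 (Fintype.card X)) := by
    intro u v h
    have h : r u = r v := congrArg Subtype.val h
    rcases lt_trichotomy (key u) (key v) with h' | h' | h'
    · exact absurd h (hr u v h').ne
    · exact hkinj h'
    · exact absurd h (hr v u h').ne'
  have hbij := (Fintype.bijective_iff_injective_and_card _).2 ⟨hinj, by simp⟩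
  refine ⟨⟨Equiv.ofBijective _ hbij, fun u v h => hr u v (hkmono u v h)⟩, fun u v h => ?_⟩
  have h : r u ≤ r v := h
  have hk : key u ≤ key v := not_lt.1 fun h' => absurd (hr v u h') (by omega)
  exact Prod.Lex.monotone_fst _ _ hk

instance : Nonempty (LinExt X) :=
  ⟨(exists_compatible (w := fun _ : X => 0) (fun _ _ _ => le_rfl)).choose⟩

/-- Partial sums of the gaps `g` along the linear extension `f`. -/
def partialSum (f : LinExt X) (g : X → ℕ) (u : X) : ℕ := ∑ v ∈ f.initial (f.rank u), g v

theorem monotone_partialSum (f : LinExt X) (g : X → ℕ) : Monotone (f.partialSum g) := by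
  intro u v h
  apply sum_le_sum_of_subset
  intro t
  simp only [mem_initial]
  exact fun ht => ht.trans (f.rank_strictMono.monotone h)

theorem partialSum_le_sum (f : LinExt X) (g : X → ℕ) (u : X) : f.partialSum g u ≤ ∑ v, g v :=
  sum_le_sum_of_subset (subset_univ _)

/-- Positive gaps exclude ties, so the partial sums recover the order of `f`. -/
theorem partialSum_le_partialSum_iff {f : LinExt X} {g : X → ℕ} (hg : ∀ v, 1 ≤ g v) (u v : X) :
    f.partialSum g u ≤ f.partialSum g v ↔ f.rank u ≤ f.rank v := by
  constructor
  · contrapose!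
    intro h
    refine sum_lt_sum_of_subset (i := u) (fun t => ?_) (mem_initial.2 le_rfl) ?_ (hg u)
      fun _ _ _ => Nat.zero_le _
    · simp only [mem_initial]
      omega
    · rw [mem_initial]
      omega
  · intro h
    apply sum_le_sum_of_subset
    intro t
    simp only [mem_initial]
    omega

theorem eq_of_partialSum_eq {f : LinExt X} {g g' : X → ℕ}
    (h : f.partialSum g = f.partialSum g') : g = g' := by
  classical
  have key : ∀ m u, f.rank u = m → g u = g' u := by
    intro m
    induction m using Nat.strong_induction_on with
    | _ m ih =>
      intro u hu
      obtain ⟨k, rfl⟩ : ∃ k, m = k + 1 := ⟨m - 1, by have := f.one_le_rank u; omega⟩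
      have h1 := congrFun h u
      simp only [partialSum, hu, f.initial_succ hu, sum_insert (notMem_initial hu)] at h1
      have h2 : ∑ v ∈ f.initial k, g v = ∑ v ∈ f.initial k, g' v :=
        sum_congr rfl fun v hv => ih _ (Nat.lt_succ_of_le (mem_initial.1 hv)) v rfl
      omega
  exact funext fun u => key _ u rfl

/-- With positive gaps, the linear extension and the gaps are determined by the partial sums. -/
theorem partialSum_injective {f f' : LinExt X} {g g' : X → ℕ} (hg : ∀ v, 1 ≤ g v)
    (hg' : ∀ v, 1 ≤ g' v) (h : f.partialSum g = f'.partialSum g') : f = f' ∧ g = g' := by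
  have hf : f = f' := by
    apply rank_ext
    intro u
    rw [← f.card_initial_rank u, ← f'.card_initial_rank u]
    congr 1
    ext v
    rw [mem_initial, mem_initial, ← partialSum_le_partialSum_iff hg,
      ← partialSum_le_partialSum_iff hg', h]
  subst hf
  exact ⟨rfl, eq_of_partialSum_eq h⟩

/-- Every monotone map is the family of partial sums of its gaps along a compatible linear
extension. -/
theorem exists_partialSum_eq {w : X → ℕ} (hw : Monotone w) :
    ∃ (f : LinExt X) (g : X → ℕ), f.partialSum g = w ∧ ∑ v, g v = univ.sup w ∧
      ∀ v, g v ≤ w v := by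
  classical
  obtain ⟨f, hf⟩ := exists_compatible hw
  -- The gap is the increase over the largest earlier value; the empty supremum is 0, so the first
  -- gap is the first value itself.
  let g : X → ℕ := fun u => w u - (f.initial (f.rank u - 1)).sup w
  have key : ∀ m ≤ Fintype.card X, ∑ v ∈ f.initial m, g v = (f.initial m).sup w := by
    intro m
    induction m with
    | zero => simp [initial_zero]
    | succ m ih =>
      intro hm
      obtain ⟨u, hu⟩ := f.exists_rank_eq (Nat.succ_pos m) hm
      rw [f.initial_succ hu, sum_insert (notMem_initial hu), sup_insert, ih (by omega)]
      have h1 : g u = w u - (f.initial m).sup w := by simp [g, hu]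
      have h2 : (f.initial m).sup w ≤ w u :=
        Finset.sup_le fun v hv => hf v u (by rw [mem_initial] at hv; omega)
      rw [h1, sup_of_le_left h2, Nat.sub_add_cancel h2]
  refine ⟨f, g, funext fun u => ?_, ?_, fun v => Nat.sub_le _ _⟩
  · rw [partialSum, key _ (f.rank_le_card u)]
    exact le_antisymm (Finset.sup_le fun v hv => hf v u (mem_initial.1 hv))
      (le_sup (f := w) (mem_initial.2 le_rfl))
  · rw [← f.initial_card]
    exact key _ le_rfl

end LinExt

/-! ### Moments of independent geometric gaps. -/

namespace LinExt

open Finset Filter Topology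

/-- The sum over a box of a geometric weight times a monomial factors. -/
theorem sum_box_eq_prod {X : Type*} [Fintype X] [DecidableEq X] (q : ℝ) (s : Finset ℕ) (m : X → ℕ) :
    ∑ g ∈ Fintype.piFinset fun _ : X => s, q ^ (∑ v, g v) * ∏ v, (g v : ℝ) ^ m v =
      ∏ v, ∑ j ∈ s, q ^ j * (j : ℝ) ^ m v := by
  rw [prod_univ_sum]
  refine sum_congr rfl fun g _ => ?_
  rw [← prod_pow_eq_pow_sum, prod_mul_distrib]

theorem prod_pow_single {X : Type*} [Fintype X] [DecidableEq X] (g : X → ℕ) (a : X) :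
    ∏ v, (g v : ℝ) ^ (if v = a then 1 else 0) = g a := by
  simp

theorem prod_pow_pair {X : Type*} [Fintype X] [DecidableEq X] (g : X → ℕ) (a b : X) :
    ∏ v, (g v : ℝ) ^ ((if v = a then 1 else 0) + if v = b then 1 else 0) = g a * g b := by
  simp only [pow_add, prod_mul_distrib, prod_pow_single]

theorem geometric_moment_zero_le {q : ℝ} (hq : 0 < q) (hq1 : q < 1) (T : ℕ) :
    ∑ j ∈ range T, q ^ j * (j : ℝ) ^ 0 ≤ (1 - q)⁻¹ := by
  simp only [pow_zero, mul_one]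
  exact sum_le_hasSum _ (fun j _ => by positivity) (hasSum_geometric_of_lt_one hq.le hq1)

theorem geometric_moment_one_le {q : ℝ} (hq : 0 < q) (hq1 : q < 1) (T : ℕ) :
    ∑ j ∈ range T, q ^ j * (j : ℝ) ^ 1 ≤ (1 - q)⁻¹ ^ 2 := by
  have h := hasSum_coe_mul_geometric_of_norm_lt_one (r := q)
    (by rwa [Real.norm_of_nonneg hq.le])
  have h1 := sum_le_hasSum (range T) (fun j _ => by positivity) h
  calc ∑ j ∈ range T, q ^ j * (j : ℝ) ^ 1 = ∑ j ∈ range T, (j : ℝ) * q ^ j :=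
        sum_congr rfl fun j _ => by ring
    _ ≤ q / (1 - q) ^ 2 := h1
    _ ≤ 1 / (1 - q) ^ 2 := by gcongr
    _ = (1 - q)⁻¹ ^ 2 := by rw [inv_pow, one_div]

/-- The moments of order at most two of a geometric weight on the positive integers. -/
theorem exists_tendsto_geometric_moment {q : ℝ} (hq : 0 < q) (hq1 : q < 1) {m : ℕ} (hm : m ≤ 2) :
    ∃ s : ℝ, q ^ 2 * m.factorial * (1 - q)⁻¹ ^ (m + 1) ≤ s ∧
      Tendsto (fun K : ℕ => ∑ j ∈ Ico 1 (K + 1), q ^ j * (j : ℝ) ^ m) atTop (𝓝 s) := by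
  have hp : 0 < 1 - q := by linarith
  have hn : ‖q‖ < 1 := by rwa [Real.norm_of_nonneg hq.le]
  have c (k : ℕ) := hasSum_choose_mul_geometric_of_norm_lt_one k hn
  have aux : ∀ s : ℝ, HasSum (fun j : ℕ => q ^ (j + 1) * ((j : ℝ) + 1) ^ m) s →
      Tendsto (fun K : ℕ => ∑ j ∈ Ico 1 (K + 1), q ^ j * (j : ℝ) ^ m) atTop (𝓝 s) := by
    intro s hs
    refine hs.tendsto_sum_nat.congr fun K => ?_
    rw [sum_Ico_eq_sum_range, Nat.add_sub_cancel]
    refine sum_congr rfl fun j _ => ?_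
    rw [add_comm 1 j]
    push_cast
    rfl
  interval_cases m
  · refine ⟨q * (1 / (1 - q) ^ 1), ?_, aux _ ?_⟩
    · have : q ^ 2 ≤ q := by nlinarith
      simp only [Nat.factorial, Nat.cast_one, mul_one, zero_add, inv_pow, one_div]
      gcongr
    · convert! (c 0).mul_left q using 2 with j
      simp
      ring
  · refine ⟨q * (1 / (1 - q) ^ 2), ?_, aux _ ?_⟩
    · have : q ^ 2 ≤ q := by nlinarith
      simp only [Nat.factorial, Nat.cast_one, mul_one, inv_pow, one_div]
      norm_num
      gcongr
    · convert! (c 1).mul_left q using 2 with j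
      simp
      ring
  -- Uses `(j + 1)^2 = 2 * choose (j + 2) 2 - choose (j + 1) 1`.
  · refine ⟨q * (2 * (1 / (1 - q) ^ 3) - 1 / (1 - q) ^ 2), ?_, aux _ ?_⟩
    · have : q * (2 * (1 / (1 - q) ^ 3) - 1 / (1 - q) ^ 2) = q * (1 + q) * (1 - q)⁻¹ ^ 3 := by
        field_simp
        ring
      rw [this]
      have : q ^ 2 * ((2 : ℕ).factorial : ℝ) ≤ q * (1 + q) := by
        norm_num [Nat.factorial]
        nlinarith
      gcongr
    · convert! (((c 2).mul_left 2).sub (c 1)).mul_left q using 2 with j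
      rw [Nat.cast_choose_two]
      simp only [Nat.choose_one_right]
      push_cast
      ring

theorem exists_tendsto_sum_box_one {X : Type*} [Fintype X] [DecidableEq X] {q : ℝ} (hq : 0 < q) (hq1 : q < 1) :
    ∃ s : ℝ, q ^ (2 * Fintype.card X) * (1 - q)⁻¹ ^ Fintype.card X ≤ s ∧
      Tendsto (fun K : ℕ => ∑ g ∈ Fintype.piFinset fun _ : X => Ico 1 (K + 1), q ^ (∑ v, g v))
        atTop (𝓝 s) := by
  have hp : 0 < 1 - q := by linarith
  obtain ⟨s, hs, ht⟩ := exists_tendsto_geometric_moment hq hq1 (Nat.zero_le 2)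
  refine ⟨∏ _v : X, s, ?_, ?_⟩
  · rw [pow_mul, ← mul_pow, prod_const, Finset.card_univ]
    have : q ^ 2 * (1 - q)⁻¹ ≤ s := by simpa using hs
    gcongr
  · refine (tendsto_finsetProd (univ : Finset X) fun v _ => ht).congr fun K => ?_
    rw [← sum_box_eq_prod]
    simp

/-- The factor `1 + [a = b]` is the mixed second moment of two Exp(1) variables, equal or
independent. Summed over pairs from `r` elements it gives `r^2 + r`. -/
theorem exists_tendsto_sum_box_pair {X : Type*} [Fintype X] [DecidableEq X] {q : ℝ} (hq : 0 < q) (hq1 : q < 1)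
    (a b : X) :
    ∃ s : ℝ, q ^ (2 * Fintype.card X) * (1 - q)⁻¹ ^ (Fintype.card X + 2) *
        (1 + if a = b then 1 else 0) ≤ s ∧
      Tendsto (fun K : ℕ => ∑ g ∈ Fintype.piFinset fun _ : X => Ico 1 (K + 1),
        q ^ (∑ v, g v) * ((g a : ℝ) * g b)) atTop (𝓝 s) := by
  have hp : 0 < 1 - q := by linarith
  let m : X → ℕ := fun v => (if v = a then 1 else 0) + if v = b then 1 else 0
  have hm : ∀ v, m v ≤ 2 := fun v => by simp only [m]; split_ifs <;> omega
  choose s hs ht using fun v => exists_tendsto_geometric_moment hq hq1 (hm v)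
  refine ⟨∏ v, s v, ?_, ?_⟩
  · refine le_trans (le_of_eq ?_) (prod_le_prod (fun v _ => by positivity) fun v _ => hs v)
    rw [prod_mul_distrib, prod_mul_distrib, prod_const, prod_pow_eq_pow_sum, Finset.card_univ,
      ← pow_mul]
    have h1 : ∑ v, (m v + 1) = Fintype.card X + 2 := by
      simp [m, sum_add_distrib]
      ring
    have h2 : ∏ v, ((m v).factorial : ℝ) = 1 + if a = b then 1 else 0 := by
      rw [prod_eq_single a]
      · by_cases h : a = b <;> (simp [m, h]; try norm_num)
      · intro v _ hv
        by_cases h : v = b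
        · subst h
          simp [m, hv]
        · simp [m, h, hv]
      · simp
    rw [h1, h2]
    ring
  · refine (tendsto_finsetProd (univ : Finset X) fun v _ => ht v).congr fun K => ?_
    rw [← sum_box_eq_prod]
    simp only [m, prod_pow_pair]

/-! ### Comparison of monotone maps with gap vectors. -/

variable {X : Type*} [Fintype X] [PartialOrder X]

/-- Sum over all linear extensions and all gap vectors in a box, weighted geometrically. -/
theorem sum_gaps_le_sum_boundedMonotone [DecidableEq X] {q : ℝ} (hq : 0 < q) (hq1 : q ≤ 1)
    {φ : ℕ → ℝ} (hφ : ∀ k, 0 ≤ φ k) (K : ℕ) (x : X) :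
    ∑ f : LinExt X, ∑ g ∈ Fintype.piFinset fun _ : X => Ico 1 (K + 1),
        q ^ (∑ v, g v) * φ (f.partialSum g x) ≤
      ∑ w ∈ boundedMonotone X (Fintype.card X * K + 1), q ^ univ.sup w * φ (w x) := by
  classical
  rw [← sum_product']
  have hmem : ∀ g ∈ Fintype.piFinset fun _ : X => Ico 1 (K + 1), ∀ v, 1 ≤ g v ∧ g v ≤ K :=
    fun g hg v => by
      have := mem_Ico.1 (Fintype.mem_piFinset.1 hg v)
      omega
  refine (sum_le_sum (g := fun p : LinExt X × (X → ℕ) =>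
    q ^ univ.sup (p.1.partialSum p.2) * φ (p.1.partialSum p.2 x)) fun p _ => ?_).trans ?_
  · refine mul_le_mul_of_nonneg_right (pow_le_pow_of_le_one hq.le hq1 ?_) (hφ _)
    exact Finset.sup_le fun u _ => p.1.partialSum_le_sum p.2 u
  · rw [← sum_image (f := fun w : X → ℕ => q ^ univ.sup w * φ (w x))
      (g := fun p : LinExt X × (X → ℕ) => p.1.partialSum p.2)]
    · refine sum_le_sum_of_subset_of_nonneg ?_ fun w _ _ => mul_nonneg (by positivity) (hφ _)
      intro w hw
      obtain ⟨p, hp, rfl⟩ := mem_image.1 hw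
      have hp := hmem _ (mem_product.1 hp).2
      refine mem_boundedMonotone.2 ⟨fun u => Nat.lt_succ_of_le
        ((p.1.partialSum_le_sum p.2 u).trans ?_), p.1.monotone_partialSum p.2⟩
      simpa using sum_le_card_nsmul univ p.2 K fun v _ => (hp v).2
    -- Gaps start at 1 in this box, which makes the encoding injective.
    · intro p hp p' hp' h
      have hp := hmem _ (mem_product.1 (mem_coe.1 hp)).2
      have hp' := hmem _ (mem_product.1 (mem_coe.1 hp')).2
      obtain ⟨h1, h2⟩ := partialSum_injective (fun v => (hp v).1) (fun v => (hp' v).1) h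
      exact Prod.ext h1 h2

/-- Allowing zero gaps makes every monotone map arise, possibly several times because of ties; one
chosen decomposition per map injects into the sum on the right. -/
theorem sum_boundedMonotone_le_sum_gaps [DecidableEq X] {q : ℝ} (hq : 0 < q)
    {φ : ℕ → ℝ} (hφ : ∀ k, 0 ≤ φ k) (T : ℕ) (x : X) :
    ∑ w ∈ boundedMonotone X T, q ^ univ.sup w * φ (w x) ≤
      ∑ f : LinExt X, ∑ g ∈ Fintype.piFinset fun _ : X => range T,
        q ^ (∑ v, g v) * φ (f.partialSum g x) := by
  classical
  rw [← sum_product']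
  choose! F G h1 h2 h3 using fun (w : X → ℕ) (hw : Monotone w) => exists_partialSum_eq hw
  have hmono : ∀ w ∈ boundedMonotone X T, Monotone w := fun w hw => (mem_boundedMonotone.1 hw).2
  have hinj : Set.InjOn (fun w => (F w, G w)) (boundedMonotone X T : Set (X → ℕ)) := by
    intro w hw w' hw' h
    simp only [Prod.mk.injEq] at h
    rw [← h1 w (hmono w hw), ← h1 w' (hmono w' hw'), h.1, h.2]
  calc ∑ w ∈ boundedMonotone X T, q ^ univ.sup w * φ (w x)
      = ∑ w ∈ boundedMonotone X T, q ^ (∑ v, G w v) * φ ((F w).partialSum (G w) x) :=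
        sum_congr rfl fun w hw => by rw [h1 w (hmono w hw), h2 w (hmono w hw)]
    _ = ∑ p ∈ (boundedMonotone X T).image fun w => (F w, G w),
          q ^ (∑ v, p.2 v) * φ (p.1.partialSum p.2 x) :=
        (sum_image (f := fun p : LinExt X × (X → ℕ) =>
          q ^ (∑ v, p.2 v) * φ (p.1.partialSum p.2 x)) hinj).symm
    _ ≤ _ := by
        refine sum_le_sum_of_subset_of_nonneg ?_ fun p _ _ => mul_nonneg (by positivity) (hφ _)
        intro p hp
        obtain ⟨w, hw, rfl⟩ := mem_image.1 hp
        refine mem_product.2 ⟨mem_univ _, Fintype.mem_piFinset.2 fun v => mem_range.2 ?_⟩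
        exact (h3 w (hmono w hw) v).trans_lt ((mem_boundedMonotone.1 hw).1 v)

theorem cast_partialSum (f : LinExt X) (g : X → ℕ) (u : X) :
    (f.partialSum g u : ℝ) = ∑ v ∈ f.initial (f.rank u), (g v : ℝ) := by
  simp [partialSum]

/-- Upper bound for the geometrically weighted first moment of a partial sum. -/
theorem sum_box_partialSum_le [DecidableEq X] {q : ℝ} (hq : 0 < q) (hq1 : q < 1) (T : ℕ)
    (f : LinExt X) (x : X) :
    ∑ g ∈ Fintype.piFinset fun _ : X => range T, q ^ (∑ v, g v) * ((f.partialSum g x : ℝ) + 1) ≤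
      (1 - q)⁻¹ ^ (Fintype.card X + 1) * (f.rank x + (1 - q)) := by
  have hp : 0 < 1 - q := by linarith
  have e0 : ∑ g ∈ Fintype.piFinset fun _ : X => range T, q ^ (∑ v, g v) ≤
      (1 - q)⁻¹ ^ Fintype.card X := by
    have := sum_box_eq_prod (X := X) q (range T) fun _ => 0
    simp only [pow_zero, prod_const_one, mul_one] at this
    rw [this]
    refine (prod_le_prod (fun v _ => sum_nonneg fun j _ => by positivity)
      fun v _ => ?_).trans_eq (prod_const _)
    simpa using geometric_moment_zero_le hq hq1 T
  have e1 : ∀ a : X, ∑ g ∈ Fintype.piFinset fun _ : X => range T, q ^ (∑ v, g v) * (g a : ℝ) ≤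
      (1 - q)⁻¹ ^ (Fintype.card X + 1) := by
    intro a
    have := sum_box_eq_prod (X := X) q (range T) fun v => if v = a then 1 else 0
    simp only [prod_pow_single] at this
    rw [this]
    refine (prod_le_prod (g := fun v => (1 - q)⁻¹ ^ (1 + if v = a then 1 else 0))
      (fun v _ => sum_nonneg fun j _ => by positivity) fun v _ => ?_).trans_eq ?_
    · by_cases h : v = a
      · simpa [h] using geometric_moment_one_le hq hq1 T
      · simpa [h] using geometric_moment_zero_le hq hq1 T
    · rw [prod_pow_eq_pow_sum]
      simp [sum_add_distrib]
  simp only [cast_partialSum, mul_add, mul_one, sum_add_distrib, mul_sum]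
  rw [sum_comm]
  refine (add_le_add (sum_le_sum fun a _ => e1 a) e0).trans_eq ?_
  rw [sum_const, card_initial_rank, nsmul_eq_mul, pow_succ]
  field_simp

end LinExt

/-! ### The limit `q → 1` and the moment inequality. -/

namespace LinExt

open Finset Filter Topology

variable {X : Type*} [Fintype X] [PartialOrder X]

/-- Positive gaps bound the total mass and second moment from below, nonnegative gaps bound the
first moment from above. Each lower bound costs `q ^ (2 * n)`, with `n` the size of `X`. -/
theorem second_moment_le_of_geometric {q : ℝ} (hq : 0 < q) (hq1 : q < 1) (x : X) :
    q ^ (4 * Fintype.card X) * (Fintype.card (LinExt X) *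
        ∑ f : LinExt X, ((f.rank x : ℝ) ^ 2 + f.rank x)) ≤
      2 * (∑ f : LinExt X, ((f.rank x : ℝ) + (1 - q))) ^ 2 := by
  classical
  have hp : 0 < 1 - q := by linarith
  obtain ⟨s, hs, ht⟩ := exists_tendsto_sum_box_one (X := X) hq hq1
  choose r hr hrt using exists_tendsto_sum_box_pair (X := X) hq hq1
  set n := Fintype.card X
  have h0 : Tendsto (fun K : ℕ => ∑ _f : LinExt X,
      ∑ g ∈ Fintype.piFinset fun _ : X => Ico 1 (K + 1), q ^ (∑ v, g v)) atTop
      (𝓝 (∑ _f : LinExt X, s)) := tendsto_finsetSum _ fun f _ => ht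
  have h2 : Tendsto (fun K : ℕ => ∑ f : LinExt X,
      ∑ g ∈ Fintype.piFinset fun _ : X => Ico 1 (K + 1),
        q ^ (∑ v, g v) * (f.partialSum g x : ℝ) ^ 2) atTop
      (𝓝 (∑ f : LinExt X, ∑ a ∈ f.initial (f.rank x), ∑ b ∈ f.initial (f.rank x), r a b)) := by
    refine (tendsto_finsetSum _ fun f _ => tendsto_finsetSum _ fun a _ =>
      tendsto_finsetSum _ fun b _ => hrt a b).congr fun K => ?_
    refine sum_congr rfl fun f _ => ?_
    refine (sum_congr rfl fun a _ => sum_comm).trans ?_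
    rw [sum_comm]
    refine sum_congr rfl fun g _ => ?_
    rw [cast_partialSum, sq, sum_mul_sum, mul_sum]
    exact sum_congr rfl fun a _ => (mul_sum _ _ _).symm
  have hle : (∑ _f : LinExt X, s) *
      (∑ f : LinExt X, ∑ a ∈ f.initial (f.rank x), ∑ b ∈ f.initial (f.rank x), r a b) ≤
      2 * (∑ f : LinExt X, (1 - q)⁻¹ ^ (n + 1) * ((f.rank x : ℝ) + (1 - q))) ^ 2 := by
    -- The right side does not depend on `K`, so the bound for each finite box survives the limit.
    refine le_of_tendsto (h0.mul h2) (Eventually.of_forall fun K => ?_)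
    have l0 := sum_gaps_le_sum_boundedMonotone hq hq1.le (φ := fun _ => 1)
      (fun _ => zero_le_one) K x
    have l2 := sum_gaps_le_sum_boundedMonotone hq hq1.le (φ := fun k => (k : ℝ) ^ 2)
      (fun _ => by positivity) K x
    have u1 := (sum_boundedMonotone_le_sum_gaps hq (φ := fun k => (k : ℝ) + 1)
      (fun _ => by positivity) (n * K + 1) x).trans
      (sum_le_sum fun f _ => sum_box_partialSum_le hq hq1 (n * K + 1) f x)
    simp only [mul_one] at l0
    refine (mul_le_mul l0 l2 (sum_nonneg fun f _ => sum_nonneg fun g _ => by positivity)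
      (sum_nonneg fun f _ => by positivity)).trans ?_
    refine (weighted_second_moment_le hq hq1.le (n * K + 1) x).trans ?_
    have := sum_nonneg fun w (_ : w ∈ boundedMonotone X (n * K + 1)) =>
      (by positivity : 0 ≤ q ^ univ.sup w * ((w x : ℝ) + 1))
    gcongr
  have hs' : (Fintype.card (LinExt X) : ℝ) * (q ^ (2 * n) * (1 - q)⁻¹ ^ n) ≤
      ∑ _f : LinExt X, s := by
    rw [sum_const, nsmul_eq_mul, Finset.card_univ]
    gcongr
  have hr' : q ^ (2 * n) * (1 - q)⁻¹ ^ (n + 2) *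
      ∑ f : LinExt X, ((f.rank x : ℝ) ^ 2 + f.rank x) ≤
      ∑ f : LinExt X, ∑ a ∈ f.initial (f.rank x), ∑ b ∈ f.initial (f.rank x), r a b := by
    rw [mul_sum]
    refine sum_le_sum fun f _ => le_trans (le_of_eq ?_)
      (sum_le_sum fun a _ => sum_le_sum fun b _ => hr a b)
    simp only [← mul_sum, sum_add_distrib, sum_const, nsmul_eq_mul, mul_one, sum_ite_eq,
      card_initial_rank]
    rw [sum_ite_mem, inter_self, sum_const, card_initial_rank, nsmul_eq_mul]
    ring
  rw [← mul_sum] at hle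
  have hnn : 0 ≤ ∑ f : LinExt X, ((f.rank x : ℝ) ^ 2 + f.rank x) :=
    sum_nonneg fun f _ => by positivity
  have hi : 0 < (1 - q)⁻¹ := inv_pos.2 hp
  generalize ∑ f : LinExt X, ((f.rank x : ℝ) ^ 2 + f.rank x) = S at hr' hnn ⊢
  generalize ∑ f : LinExt X, ((f.rank x : ℝ) + (1 - q)) = R at hle ⊢
  generalize (1 - q)⁻¹ = c at *
  have key := (mul_le_mul hs' hr' (by positivity) (le_trans (by positivity) hs')).trans hle
  -- Both sides carry the same power of `c = (1 - q)⁻¹`: `n + (n + 2) = 2 * (n + 1)`.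
  refine le_of_mul_le_mul_left (a := c ^ (2 * n + 2)) ?_ (by positivity)
  calc c ^ (2 * n + 2) * (q ^ (4 * n) * (Fintype.card (LinExt X) * S))
      = Fintype.card (LinExt X) * (q ^ (2 * n) * c ^ n) * (q ^ (2 * n) * c ^ (n + 2) * S) := by
        ring
    _ ≤ 2 * (c ^ (n + 1) * R) ^ 2 := key
    _ = c ^ (2 * n + 2) * (2 * R ^ 2) := by ring

/-- The second rising moment of `f x` is at most twice the square of its mean. -/
theorem second_moment_le (x : X) :
    (Fintype.card (LinExt X) : ℝ) * ∑ f : LinExt X, ((f.rank x : ℝ) ^ 2 + f.rank x) ≤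
      2 * (∑ f : LinExt X, (f.rank x : ℝ)) ^ 2 := by
  have hl : Tendsto (fun q : ℝ => q ^ (4 * Fintype.card X) * (Fintype.card (LinExt X) *
      ∑ f : LinExt X, ((f.rank x : ℝ) ^ 2 + f.rank x))) (𝓝[<] 1)
      (𝓝 (1 ^ (4 * Fintype.card X) * (Fintype.card (LinExt X) *
        ∑ f : LinExt X, ((f.rank x : ℝ) ^ 2 + f.rank x)))) :=
    (Continuous.tendsto (by fun_prop) 1).mono_left nhdsWithin_le_nhds
  have hr : Tendsto (fun q : ℝ => 2 * (∑ f : LinExt X, ((f.rank x : ℝ) + (1 - q))) ^ 2) (𝓝[<] 1)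
      (𝓝 (2 * (∑ f : LinExt X, ((f.rank x : ℝ) + (1 - 1))) ^ 2)) :=
    (Continuous.tendsto (f := fun q : ℝ => 2 * (∑ f : LinExt X, ((f.rank x : ℝ) + (1 - q))) ^ 2)
      (by fun_prop) 1).mono_left nhdsWithin_le_nhds
  have := le_of_tendsto_of_tendsto hl hr (by
    filter_upwards [Ioo_mem_nhdsLT (zero_lt_one' ℝ)] with q hq
    exact second_moment_le_of_geometric hq.1 hq.2 x)
  simpa using this

/-! ### Expectations and the passage to two elements. -/

theorem val_eq_rank (f : LinExt X) (x : X) : f.val x = f.rank x := rfl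

theorem one_le_val (f : LinExt X) (x : X) : 1 ≤ f.val x := by
  rw [val_eq_rank]
  exact_mod_cast f.one_le_rank x

theorem expect_mono {g h : LinExt X → ℝ} (hgh : ∀ f, g f ≤ h f) : expect g ≤ expect h :=
  div_le_div_of_nonneg_right (sum_le_sum fun f _ => hgh f) (Nat.cast_nonneg _)

theorem expect_add (g h : LinExt X → ℝ) :
    expect (fun f => g f + h f) = expect g + expect h := by
  simp [expect, sum_add_distrib, add_div]

theorem expect_const_mul (c : ℝ) (g : LinExt X → ℝ) :
    expect (fun f => c * g f) = c * expect g := by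
  simp [expect, ← mul_sum, mul_div_assoc]

theorem expect_const (c : ℝ) : expect (fun _ : LinExt X => c) = c := by
  simp [expect]

theorem cov_eq (g h : LinExt X → ℝ) :
    cov g h = expect (fun f => g f * h f) - expect g * expect h := by
  have : (fun f => (g f - expect g) * (h f - expect h)) = fun f => g f * h f +
      (-expect h * g f + (-expect g * h f + expect g * expect h)) := by
    funext f
    ring
  rw [cov, this, expect_add, expect_add, expect_add, expect_const_mul, expect_const_mul,
    expect_const]
  ring

theorem expect_val_pos (x : X) : 0 < expect fun f : LinExt X => f.val x :=
  zero_lt_one.trans_le ((expect_const (X := X) 1).symm.le.trans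
    (expect_mono fun f => f.one_le_val x))

theorem expect_sq_add_le (x : X) :
    expect (fun f : LinExt X => f.val x ^ 2 + f.val x) ≤
      2 * expect (fun f : LinExt X => f.val x) ^ 2 := by
  have h := second_moment_le x
  have hc : (0 : ℝ) < Fintype.card (LinExt X) := by exact_mod_cast Fintype.card_pos
  simp only [expect, val_eq_rank]
  rw [div_pow, ← mul_div_assoc, div_le_div_iff₀ hc (by positivity)]
  nlinarith [mul_le_mul_of_nonneg_left h hc.le]

/-- The product part is `(t * a - b)^2 ≥ 0`; the minimum part is `t + t⁻¹ ≥ 2` with `min a b` at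
most each of `a`, `b`. -/
theorem two_mul_add_min_le {a b t : ℝ} (ha : 0 ≤ a) (hb : 0 ≤ b) (ht : 0 < t) :
    2 * (a * b + min a b) ≤ t * (a ^ 2 + a) + t⁻¹ * (b ^ 2 + b) := by
  have h1 : 2 * (a * b) ≤ t * a ^ 2 + t⁻¹ * b ^ 2 := by
    have : t * a ^ 2 + t⁻¹ * b ^ 2 - 2 * (a * b) = t⁻¹ * (t * a - b) ^ 2 := by
      field_simp
      ring
    have : 0 ≤ t⁻¹ * (t * a - b) ^ 2 := by positivity
    linarith
  have h2 : 2 * min a b ≤ t * a + t⁻¹ * b := by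
    have hm : 0 ≤ min a b := le_min ha hb
    have : t * min a b + t⁻¹ * min a b - 2 * min a b = t⁻¹ * (t - 1) ^ 2 * min a b := by
      field_simp
      ring
    have : 0 ≤ t⁻¹ * (t - 1) ^ 2 * min a b := by positivity
    have : t * min a b ≤ t * a := by gcongr; exact min_le_left _ _
    have : t⁻¹ * min a b ≤ t⁻¹ * b := by gcongr; exact min_le_right _ _
    linarith
  linarith

theorem expect_mul_add_expect_min_le (x y : X) :
    expect (fun f : LinExt X => f.val x * f.val y) +
        expect (fun f : LinExt X => min (f.val x) (f.val y)) ≤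
      2 * (expect (fun f : LinExt X => f.val x) * expect (fun f : LinExt X => f.val y)) := by
  have hx := expect_val_pos x
  have hy := expect_val_pos y
  have h2x := expect_sq_add_le x
  have h2y := expect_sq_add_le y
  set ex := expect fun f : LinExt X => f.val x
  set ey := expect fun f : LinExt X => f.val y
  -- The choice `t = ey / ex` balances the two terms: each is then at most `2 * (ex * ey)`.
  have ht : 0 < ey / ex := div_pos hy hx
  have h := expect_mono fun f : LinExt X => two_mul_add_min_le
    (zero_le_one.trans (f.one_le_val x)) (zero_le_one.trans (f.one_le_val y)) ht
  rw [expect_const_mul, expect_add, expect_add, expect_const_mul, expect_const_mul] at h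
  have h1 := mul_le_mul_of_nonneg_left h2x ht.le
  have h2 := mul_le_mul_of_nonneg_left h2y (inv_nonneg.2 ht.le)
  have h3 : ey / ex * (2 * ex ^ 2) = 2 * (ex * ey) := by field_simp
  have h4 : (ey / ex)⁻¹ * (2 * ey ^ 2) = 2 * (ex * ey) := by field_simp
  linarith

end LinExt

theorem theorem1p2 {X : Type*} [Fintype X] [PartialOrder X] (x y : X) :
    0 < LinExt.expect (fun f : LinExt X => f.val x) *
        LinExt.expect (fun f : LinExt X => f.val y) ∧
    (LinExt.expect (fun f : LinExt X => f.val x * f.val y) +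
        LinExt.expect (fun f : LinExt X => min (f.val x) (f.val y))) /
      (LinExt.expect (fun f : LinExt X => f.val x) *
        LinExt.expect (fun f : LinExt X => f.val y)) ≤ 2 ∧
    LinExt.cov (fun f : LinExt X => f.val x) (fun f : LinExt X => f.val y) ≤
      LinExt.expect (fun f : LinExt X => f.val x) *
        LinExt.expect (fun f : LinExt X => f.val y) := by
  have hpos := mul_pos (LinExt.expect_val_pos x) (LinExt.expect_val_pos y)
  have h := LinExt.expect_mul_add_expect_min_le x y
  refine ⟨hpos, (div_le_iff₀ hpos).2 h, ?_⟩
  have hmin : 0 ≤ LinExt.expect fun f : LinExt X => min (f.val x) (f.val y) :=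
    (LinExt.expect_const (X := X) 0).symm.le.trans (LinExt.expect_mono fun f =>
      le_min (zero_le_one.trans (f.one_le_val x)) (zero_le_one.trans (f.one_le_val y)))
  rw [LinExt.cov_eq]
  linarith
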